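/- A Borel probability measure $\sigma$ on the circle $\mathbb{R}/2\pi\mathbb{Z}$, with $\hat\sigma(n)=\int e^{int}\,d\sigma(t)$, has polynomial Fourier decay with parameter $\delta>0$ if there is $C>0$ such that $|\hat\sigma(n)|\le C|n|^{-\delta}$ for all $n\in\mathbb{Z}\setminus\{0\}$. An invertible measure-preserving transformation $T$ of a standard Borel probability space $(X,\mathcal{B},m)$ is a Gaussian automorphism with spectral measure $\sigma$ and generator $f\in L^2(X,m)$ (real-valued) if $\int f\,dm=0$, the process $(f\circ T^n)_{n\in\mathbb{Z}}$ is Gaussian, $\int f\cdot f\circ T^n\,dm=\hat\sigma(n)$ for all $n\in\mathbb{Z}$, and the $\sigma$-algebra generated by the functions $f\circ T^n$, $n\in\mathbb Z$, equals $\mathcal{B}$ modulo $m$. Let $\sigma$ be a probability measure on the circle with polynomial Fourier decay with parameter $\delta>0$, let $T$ be a Gaussian automorphism of the standard Borel probability space $(X,\mathcal{B},m)$ with spectral measure $\sigma$ and generator $f$, and let $k\in\mathbb{N}$ satisfy $2k\delta>1$. Let $U g=g\circ T$ be the Koopman operator of $T$, let $\mathcal{H}\subset L^2(X,m)$ be the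 closed linear span of $\{f\circ T^n:n\in\mathbb{Z}\}$, let $P$ be the orthogonal projection onto $\mathrm{span}\{f\}$, and let $Wg=Pg-(I-P)g$ for $g\in\mathcal{H}$. Then there exist an invertible $m$-preserving transformation $S:X\to X$, measure-theoretically isomorphic to $T$, whose Koopman operator satisfies $g\circ S=WUWg$ for all $g\in\mathcal{H}$, and a set $B\in\mathcal{B}^{\otimes k}$ with $m^{\otimes k}(B)>0$, such that for all $n\in\mathbb{Z}\setminus\{0\}$, $$B\cap (T^{\otimes k})^{-n}B\cap (S^{\otimes k})^{-n}B=\emptyset .$$ -/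

import Mathlib

open MeasureTheory ProbabilityTheory

noncomputable section

namespace GaussianRecurrence

/-- The Fourier coefficient `σ̂(n) = ∫ exp(i n t) dσ(t)` of a measure on the circle `ℝ / 2πℤ`. -/
def fourierTransform (σ : Measure (AddCircle (2 * Real.pi))) (n : ℤ) : ℂ :=
  ∫ t, fourier n t ∂σ

/-- Polynomial Fourier decay with parameter `δ`: `|σ̂(n)| ≤ C |n| ^ (-δ)` for all `n ≠ 0`. -/
def HasPolynomialFourierDecay (σ : Measure (AddCircle (2 * Real.pi))) (δ : ℝ) : Prop :=
  ∃ C : ℝ, 0 < C ∧ ∀ n : ℤ, n ≠ 0 → ‖fourierTransform σ n‖ ≤ C * |(n : ℝ)| ^ (-δ)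

/-- The `n`-th iterate, `n ∈ ℤ`, of an invertible measurable map. -/
def iter {X : Type*} [MeasurableSpace X] (T : X ≃ᵐ X) (n : ℤ) : X → X :=
  ((T.toEquiv : Equiv.Perm X) ^ n : Equiv.Perm X)

/-- The `k`-fold Cartesian power `T × ⋯ × T`. -/
def cartesianPower {X : Type*} [MeasurableSpace X] (T : X ≃ᵐ X) (k : ℕ) :
    (Fin k → X) ≃ᵐ (Fin k → X) :=
  MeasurableEquiv.piCongrRight fun _ => T

/-- `(X, m, T)` is a Gaussian automorphism with spectral measure `σ`, and `f ∈ L²(X, m)` is a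
function whose time series `f ∘ Tⁿ` is a centred Gaussian process with spectral measure `σ` that
generates the `σ`-algebra of `X` modulo `m`. -/
structure IsGaussianAutomorphism {X : Type*} [MeasurableSpace X] (m : Measure X) (T : X ≃ᵐ X)
    (σ : Measure (AddCircle (2 * Real.pi))) (f : Lp ℝ 2 m) : Prop where
  measurePreserving : MeasurePreserving T m m
  integral_eq_zero : ∫ x, f x ∂m = 0
  isGaussianProcess : IsGaussianProcess (fun (n : ℤ) (x : X) => f (iter T n x)) m
  covariance_eq : ∀ n : ℤ, ((∫ x, f x * f (iter T n x) ∂m : ℝ) : ℂ) = fourierTransform σ n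
  generates : ∀ A : Set X, MeasurableSet A → ∃ A' : Set X,
    MeasurableSet[⨆ n : ℤ, MeasurableSpace.comap (fun x => f (iter T n x)) (borel ℝ)] A' ∧
      A =ᵐ[m] A'

/-- Measure-theoretic (mod 0) isomorphism of two transformations of `(X, m)`. -/
def Isomorphic {X : Type*} [MeasurableSpace X] (m : Measure X) (T S : X ≃ᵐ X) : Prop :=
  ∃ φ ψ : X → X, MeasurePreserving φ m m ∧ MeasurePreserving ψ m m ∧
    (∀ᵐ x ∂m, ψ (φ x) = x) ∧ (∀ᵐ x ∂m, φ (ψ x) = x) ∧ ∀ᵐ x ∂m, φ (T x) = S (φ x)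

/-- The Koopman operator `g ↦ g ∘ T` on the real space `L²(X, m)`. -/
def koopman {X : Type*} [MeasurableSpace X] {m : Measure X} (T : X ≃ᵐ X)
    (hT : MeasurePreserving T m m) : Lp ℝ 2 m →ₗᵢ[ℝ] Lp ℝ 2 m :=
  Lp.compMeasurePreservingₗᵢ ℝ T hT

/-- The closed linear span in `L²(X, m)` of the functions `f ∘ Tⁿ`, `n ∈ ℤ`. -/
def gaussianSpace {X : Type*} [MeasurableSpace X] {m : Measure X} (T : X ≃ᵐ X)
    (f : Lp ℝ 2 m) : Submodule ℝ (Lp ℝ 2 m) :=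
  (Submodule.span ℝ
    {g : Lp ℝ 2 m | ∃ n : ℤ, g =ᵐ[m] fun x => f (iter T n x)}).topologicalClosure

/-- `W g = P g - (g - P g)`, where `P` is the orthogonal projection onto the line spanned
by `f`. -/
def signFlip {X : Type*} [MeasurableSpace X] {m : Measure X} (f g : Lp ℝ 2 m) : Lp ℝ 2 m :=
  (Submodule.span ℝ {f}).starProjection g - (g - (Submodule.span ℝ {f}).starProjection g)

end GaussianRecurrence

end

/-!
Write `fₙ = f ∘ Tⁿ` and let `σ̂(n) = ∫ f fₙ dm`, a real number. Since `σ` is a probability measure,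
`‖f‖ = 1`, and `W` is the reflection `W g = 2⟨f, g⟩ f - g`, which fixes `f` and sends `fₙ` to
`2 σ̂(n) f - fₙ`.

*The transformation `S`.* A centred Gaussian process is determined in law by its covariance, and `W`
is an isometry, so the processes `(fₙ)` and `(W fₙ)` have the same law (`map_reflection_eq`). Since
the `fₙ` generate the `σ`-algebra of the standard Borel space `X`, the path map `x ↦ (fₙ(x))ₙ` is
an isomorphism modulo `m` onto its image measure (`exists_measurable_ae_leftInverse`), and the
linear involution of path space given by `W` comes from an involution `e` of `X` preserving `m`, with
`fₙ ∘ e = W fₙ` almost everywhere (`exists_reflection`). Put `S = e ∘ T ∘ e⁻¹`. Then `e` conjugates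
`T` to `S`, and the Koopman operator of `S` is `W U W` on the Gaussian space (`koopman_conj_eq`).

*The set `B`.* As `W f = f`, one has `f ∘ Sⁿ = W fₙ = 2 σ̂(n) f - fₙ`, that is,
`f ∘ Tⁿ + f ∘ Sⁿ = 2 σ̂(n) f` (`comp_iter_conj`). The decay of `σ̂` forces `σ̂(n) ≤ q < 1` for all
`n ≠ 0` and some `q > 0` (`exists_autocov_le`): `σ̂(n)` tends to `0`, and `σ̂(n) = 1` for some
`n ≠ 0` would make `f` invariant under `Tⁿ` and `σ̂` equal to `1` along the multiples of `n`. If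
`f`, `f ∘ Tⁿ` and `f ∘ Sⁿ` all had values in the interval `(q, 1)` at a point, the identity would give
`2 q < 2 σ̂(n) f < 2 q`. So `D = {q < f < 1}` satisfies
`D ∩ T⁻ⁿ D ∩ S⁻ⁿ D = ∅` up to a null set, and it has positive measure because `f` is a standard
normal variable. The condition `1 < 2 k δ` enters through `1 ≤ k`, which is what the passage to
`B = Dᵏ` requires.
-/

open MeasureTheory ProbabilityTheory
open Filter Topology
open scoped InnerProductSpace

namespace GaussianRecurrence

/-! ### Standard Borel spaces modulo null sets -/

/-- A map that generates the `σ`-algebra of a standard Borel space modulo `m` has a measurable left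
inverse almost everywhere. -/
theorem exists_measurable_ae_leftInverse {X E : Type*} [MeasurableSpace X] [StandardBorelSpace X]
    [Nonempty X] [MeasurableSpace E] {m : Measure X} (F : X → E)
    (hF : ∀ A : Set X, MeasurableSet A → ∃ C : Set E, MeasurableSet C ∧ A =ᵐ[m] F ⁻¹' C) :
    ∃ G : E → X, Measurable G ∧ ∀ᵐ x ∂m, G (F x) = x := by
  classical
  obtain ⟨e, he, hinj⟩ :=
    MeasurableSpace.measurable_injection_nat_bool_of_countablySeparated X
  have hA : ∀ n, MeasurableSet {x | e x n = true} := fun n =>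
    ((measurable_pi_apply n).comp he) (measurableSet_singleton true)
  -- `e` codes a point by its memberships in countably many sets; these can be read off from `F`.
  choose C hC hAC using fun n => hF _ (hA n)
  obtain ⟨r, hr, hre⟩ := (he.measurableEmbedding hinj).exists_measurable_extend
    measurable_id (fun _ => inferInstance)
  refine ⟨fun a => r fun n => decide (a ∈ C n), hr.comp ?_, ?_⟩
  · exact measurable_pi_iff.2 fun n => measurable_to_bool (by simpa [Set.preimage] using hC n)
  · filter_upwards [ae_all_iff.2 fun n => (hAC n).mem_iff] with x hx
    have : (fun n => decide (F x ∈ C n)) = e x := by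
      funext n
      have := hx n
      simp only [Set.mem_preimage] at this
      rw [Bool.eq_iff_iff, decide_eq_true_iff, ← this]
    simp only [this]
    exact congr_fun hre x

/-- An almost everywhere involutive measurable map agrees almost everywhere with an involution:
replace it by the identity off the set of points of period two, which it preserves. -/
theorem exists_measurableEquiv_of_ae_involutive {X : Type*} [MeasurableSpace X]
    [StandardBorelSpace X] {m : Measure X} {V : X → X} (hV : Measurable V)
    (h : ∀ᵐ x ∂m, V (V x) = x) :
    ∃ e : X ≃ᵐ X, (∀ x, e (e x) = x) ∧ ∀ᵐ x ∂m, e x = V x := by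
  classical
  have hs : MeasurableSet {x | V (V x) = x} := measurableSet_eq_fun (hV.comp hV) measurable_id
  let V' : X → X := fun x => if V (V x) = x then V x else x
  have hV' : Measurable V' := Measurable.ite hs hV measurable_id
  have hinv : Function.Involutive V' := by
    intro x
    by_cases hx : V (V x) = x
    · simp [V', hx]
    · simp [V', hx]
  refine ⟨⟨hinv.toPerm V', hV', hV'⟩, hinv, ?_⟩
  filter_upwards [h] with x hx
  exact if_pos hx

/-! ### Laws of Gaussian processes -/

/-- The law of a real Gaussian process is determined by its mean and its covariance. -/
theorem map_eq_of_covariance_eq {Ω ι : Type*} [MeasurableSpace Ω] {P : Measure Ω}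
    {X Y : ι → Ω → ℝ} (hX : IsGaussianProcess X P) (hY : IsGaussianProcess Y P)
    (hXm : AEMeasurable (fun ω => (X · ω)) P) (hYm : AEMeasurable (fun ω => (Y · ω)) P)
    (hmean : ∀ i, P[X i] = P[Y i]) (hcov : ∀ i j, cov[X i, X j; P] = cov[Y i, Y j; P]) :
    P.map (fun ω => (X · ω)) = P.map (fun ω => (Y · ω)) := by
  classical
  have := hX.isProbabilityMeasure
  refine (map_eq_iff_forall_finset_map_restrict_eq hXm hYm).2 fun I => ?_
  have hIX := (hX.hasGaussianLaw I).isGaussian_map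
  have hIY := (hY.hasGaussianLaw I).isGaussian_map
  -- Mean and variance of a linear functional of the process restricted to `I`.
  have key : ∀ {Z : ι → Ω → ℝ}, IsGaussianProcess Z P → ∀ L : StrongDual ℝ (I → ℝ),
      (∫ ω, L (I.restrict (Z · ω)) ∂P = ∑ i : I, L (Pi.single i 1) * P[Z i]) ∧
      Var[fun ω => L (I.restrict (Z · ω)); P] =
        ∑ i : I, ∑ j : I, L (Pi.single i 1) * (L (Pi.single j 1) * cov[Z i, Z j; P]) := by
    intro Z hZ L
    have hexp : (fun ω => L (I.restrict (Z · ω))) =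
        fun ω => ∑ i : I, L (Pi.single i 1) * Z i ω := by
      funext ω
      conv_lhs => rw [← Finset.univ_sum_single (I.restrict (Z · ω)), map_sum]
      refine Finset.sum_congr rfl fun i _ => ?_
      have : (Pi.single i (I.restrict (Z · ω) i) : I → ℝ) = Z i ω • Pi.single i 1 := by
        rw [← Pi.single_smul]; simp
      rw [this, map_smul, smul_eq_mul, mul_comm]
    have hL2 : ∀ i : I, MemLp (fun ω => L (Pi.single i 1) * Z i ω) 2 P := fun i =>
      (hZ.hasGaussianLaw_eval i).memLp_two.const_mul _
    rw [hexp]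
    constructor
    · rw [integral_finsetSum _ fun i _ => (hL2 i).integrable (by norm_num)]
      simp_rw [integral_const_mul]
    · rw [← covariance_self (memLp_finsetSum _ fun i _ => hL2 i).aemeasurable,
        covariance_fun_sum_fun_sum hL2 hL2]
      simp_rw [covariance_const_mul_left, covariance_const_mul_right]
  refine Measure.ext_of_charFunDual (funext fun L => ?_)
  rw [(hX.hasGaussianLaw I).charFunDual_map_eq_fun, (hY.hasGaussianLaw I).charFunDual_map_eq_fun,
    (key hX L).1, (key hY L).1, (key hX L).2,
    (key hY L).2]
  simp_rw [hmean, hcov]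

/-- If `X o` is a standard normal member of a centred Gaussian process, then `x ↦ 2⟨X o, x⟩ X o - x`
is an isometry of the Gaussian space, so that it does not change the law of the process. -/
theorem map_reflection_eq {Ω ι : Type*} [MeasurableSpace Ω] {P : Measure Ω}
    {X : ι → Ω → ℝ} (hX : IsGaussianProcess X P) (hXm : ∀ i, Measurable (X i))
    (hmean : ∀ i, P[X i] = 0) (o : ι) (ho : cov[X o, X o; P] = 1) :
    P.map (fun ω i => 2 * cov[X o, X i; P] * X o ω - X i ω) = P.map (fun ω => (X · ω)) := by
  classical
  have := hX.isProbabilityMeasure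
  have hL2 : ∀ i, MemLp (X i) 2 P := fun i => (hX.hasGaussianLaw_eval i).memLp_two
  have hcL2 : ∀ (a : ℝ), MemLp (fun ω => a * X o ω) 2 P := fun a => (hL2 o).const_mul a
  have hY : IsGaussianProcess (fun i ω => 2 * cov[X o, X i; P] * X o ω - X i ω) P := by
    refine hX.of_isGaussianProcess fun i => ⟨{o, i},
      (2 * cov[X o, X i; P]) • ContinuousLinearMap.proj ⟨o, by simp⟩ -
        ContinuousLinearMap.proj ⟨i, by simp⟩, fun ω => ?_⟩
    simp
  refine (map_eq_of_covariance_eq hX hY (measurable_pi_iff.2 hXm).aemeasurable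
    (measurable_pi_iff.2 fun i => ((hXm o).const_mul _).sub (hXm i)).aemeasurable
    (fun i => ?_) fun i j => ?_).symm
  · rw [integral_sub ((hcL2 _).integrable (by norm_num)) ((hL2 i).integrable (by norm_num)),
      integral_const_mul, hmean, hmean]
    simp
  · rw [covariance_fun_sub_fun_sub (hcL2 _) (hL2 i) (hcL2 _) (hL2 j)]
    simp_rw [covariance_const_mul_left, covariance_const_mul_right, ho]
    rw [covariance_comm (X i) (X o)]
    ring

/-! ### Iterates -/

theorem iter_zero {X : Type*} [MeasurableSpace X] (T : X ≃ᵐ X) (x : X) : iter T 0 x = x := rfl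

theorem iter_one {X : Type*} [MeasurableSpace X] (T : X ≃ᵐ X) (x : X) : iter T 1 x = T x := by
  simp [iter]

theorem iter_neg_one {X : Type*} [MeasurableSpace X] (T : X ≃ᵐ X) (x : X) :
    iter T (-1) x = T.symm x := by
  simp only [iter, zpow_neg, zpow_one]
  rfl

theorem iter_add {X : Type*} [MeasurableSpace X] (T : X ≃ᵐ X) (a b : ℤ) (x : X) :
    iter T (a + b) x = iter T a (iter T b x) := by
  simp [iter, zpow_add]

theorem measurePreserving_iter {X : Type*} [MeasurableSpace X] {m : Measure X} {T : X ≃ᵐ X}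
    (hT : MeasurePreserving T m m) (n : ℤ) : MeasurePreserving (iter T n) m m := by
  induction n using Int.induction_on with
  | zero => exact MeasurePreserving.id m
  | succ n ih =>
    have : iter T (n + 1) = iter T n ∘ T := funext fun x => by simp [iter_add, iter_one]
    exact this ▸ ih.comp hT
  | pred n ih =>
    have : iter T (-n - 1) = iter T (-n) ∘ T.symm := funext fun x => by
      rw [sub_eq_add_neg, iter_add, iter_neg_one, Function.comp_apply]
    exact this ▸ ih.comp (hT.symm T)

theorem iter_conj {X : Type*} [MeasurableSpace X] (T e : X ≃ᵐ X) (n : ℤ) (x : X) :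
    iter ((e.symm.trans T).trans e) n x = e (iter T n (e.symm x)) := by
  have : (((e.symm.trans T).trans e).toEquiv : Equiv.Perm X) =
      (e.toEquiv : Equiv.Perm X) * T.toEquiv * (e.toEquiv : Equiv.Perm X)⁻¹ := rfl
  simp only [iter, this, conj_zpow]
  rfl

theorem iter_cartesianPower {X : Type*} [MeasurableSpace X] (T : X ≃ᵐ X) (k : ℕ) (n : ℤ)
    (x : Fin k → X) (i : Fin k) : iter (cartesianPower T k) n x i = iter T n (x i) := by
  induction n using Int.induction_on generalizing x with
  | zero => rfl
  | succ n ih => rw [iter_add, iter_add, ih, iter_one, iter_one]; rfl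
  | pred n ih =>
    rw [sub_eq_add_neg, iter_add, iter_add, ih]
    rw [iter_neg_one, iter_neg_one]
    rfl

/-! ### The autocovariance of the generator -/

/-- The autocovariance `∫ f · (f ∘ Tⁿ) dm`, the real number whose image in `ℂ` is `σ̂(n)`
for a Gaussian automorphism `T` with spectral measure `σ`. -/
noncomputable def autocov {X : Type*} [MeasurableSpace X] (m : Measure X) (T : X ≃ᵐ X)
    (f : X → ℝ) (n : ℤ) : ℝ :=
  ∫ x, f x * f (iter T n x) ∂m

namespace IsGaussianAutomorphism

variable {X : Type*} [MeasurableSpace X] {m : Measure X} {T : X ≃ᵐ X}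
  {σ : Measure (AddCircle (2 * Real.pi))} {f : Lp ℝ 2 m}

theorem measurable_comp_iter (hT : IsGaussianAutomorphism m T σ f) (n : ℤ) :
    Measurable fun x => f (iter T n x) :=
  (Lp.stronglyMeasurable f).measurable.comp
    (measurePreserving_iter hT.measurePreserving n).measurable

theorem memLp_comp_iter (hT : IsGaussianAutomorphism m T σ f) (n : ℤ) :
    MemLp (fun x => f (iter T n x)) 2 m :=
  (hT.isGaussianProcess.hasGaussianLaw_eval n).memLp_two

theorem integral_comp_iter (hT : IsGaussianAutomorphism m T σ f) (n : ℤ) :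
    ∫ x, f (iter T n x) ∂m = 0 := by
  have h := measurePreserving_iter hT.measurePreserving n
  rw [← hT.integral_eq_zero, ← integral_map_of_stronglyMeasurable h.measurable
    (Lp.stronglyMeasurable f), h.map_eq]

theorem covariance_zero_iter [IsProbabilityMeasure m] (hT : IsGaussianAutomorphism m T σ f)
    (n : ℤ) :
    cov[fun x => f (iter T 0 x), fun x => f (iter T n x); m] = autocov m T f n := by
  rw [covariance_eq_sub (hT.memLp_comp_iter 0) (hT.memLp_comp_iter n), hT.integral_comp_iter]
  simp [autocov, iter_zero]

theorem autocov_zero [IsProbabilityMeasure σ] (hT : IsGaussianAutomorphism m T σ f) :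
    autocov m T f 0 = 1 := by
  have := hT.covariance_eq 0
  have h1 : fourierTransform σ 0 = 1 := by simp [fourierTransform]
  rw [h1] at this
  exact_mod_cast this

theorem integral_sq [IsProbabilityMeasure σ] (hT : IsGaussianAutomorphism m T σ f) :
    ∫ x, f x * f x ∂m = 1 :=
  hT.autocov_zero

theorem tendsto_autocov (hT : IsGaussianAutomorphism m T σ f) {δ : ℝ} (hδ : 0 < δ)
    (hσ : HasPolynomialFourierDecay σ δ) : Tendsto (autocov m T f) cofinite (𝓝 0) := by
  obtain ⟨C, -, hC⟩ := hσ
  have h0 : Tendsto (fun n : ℤ => C * |(n : ℝ)| ^ (-δ)) cofinite (𝓝 0) := by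
    simpa using ((tendsto_rpow_neg_atTop hδ).comp
      ((tendsto_norm_cocompact_atTop (E := ℝ)).comp Int.tendsto_coe_cofinite)).const_mul C
  refine squeeze_zero_norm' ?_ h0
  filter_upwards [(Set.finite_singleton (0 : ℤ)).compl_mem_cofinite] with n hn
  have := hC n hn
  rwa [← hT.covariance_eq, Complex.norm_real] at this

/-- If `σ̂(n) = 1`, then `f` is invariant under `Tⁿ` by the case of equality in the Cauchy–Schwarz
inequality, so that `σ̂(jn) = 1` for all `j`, against the decay of `σ̂`. -/
theorem autocov_lt_one [IsProbabilityMeasure σ] (hT : IsGaussianAutomorphism m T σ f) {δ : ℝ}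
    (hδ : 0 < δ) (hσ : HasPolynomialFourierDecay σ δ) {n : ℤ} (hn : n ≠ 0) :
    autocov m T f n < 1 := by
  have hmul : ∀ i j : ℤ, Integrable (fun x => f (iter T i x) * f (iter T j x)) m := fun i j =>
    (hT.memLp_comp_iter i).integrable_mul (hT.memLp_comp_iter j)
  have hsq : ∫ x, f (iter T n x) * f (iter T n x) ∂m = 1 := by
    have h := measurePreserving_iter hT.measurePreserving n
    have hint := integral_map_of_stronglyMeasurable (μ := m) h.measurable
      ((Lp.stronglyMeasurable f).mul (Lp.stronglyMeasurable f))
    rw [h.map_eq] at hint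
    exact hint.symm.trans hT.integral_sq
  have h00 := hmul 0 0
  have h0n := hmul 0 n
  simp only [iter_zero] at h00 h0n
  have hexp : (fun x => (f (iter T n x) - f x) ^ 2) = fun x =>
      f (iter T n x) * f (iter T n x) - 2 * (f x * f (iter T n x)) + f x * f x := by
    funext x; ring
  have hdiff : Integrable (fun x => f (iter T n x) * f (iter T n x) -
      2 * (f x * f (iter T n x))) m := (hmul n n).sub (h0n.const_mul 2)
  have hint : ∫ x, (f (iter T n x) - f x) ^ 2 ∂m = 2 - 2 * autocov m T f n := by
    rw [hexp, integral_add hdiff h00,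
      integral_sub (hmul n n) (h0n.const_mul 2), integral_const_mul, hsq, hT.integral_sq, autocov]
    ring
  have hle : autocov m T f n ≤ 1 := by
    have : 0 ≤ ∫ x, (f (iter T n x) - f x) ^ 2 ∂m := integral_nonneg fun x => sq_nonneg _
    linarith
  refine lt_of_le_of_ne hle fun heq => ?_
  rw [heq, sub_eq_zero.2 (mul_one 2).symm, integral_eq_zero_iff_of_nonneg (fun x => sq_nonneg _)
    (hexp ▸ hdiff.add h00)] at hint
  have hinv : ∀ j : ℕ, ∀ᵐ x ∂m, f (iter T (j * n) x) = f x := by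
    intro j
    induction j with
    | zero => simp [iter_zero]
    | succ j ih =>
      filter_upwards [ih, (measurePreserving_iter hT.measurePreserving
        (j * n)).quasiMeasurePreserving.ae hint] with x hx hx'
      have h1 : ((j + 1 : ℕ) : ℤ) * n = n + j * n := by push_cast; ring
      rw [h1, iter_add, ← hx]
      exact sub_eq_zero.1 (pow_eq_zero_iff two_ne_zero |>.1 hx')
  have hone : ∀ j : ℕ, autocov m T f (j * n) = 1 := fun j => by
    rw [← hT.integral_sq]
    exact integral_congr_ae ((hinv j).mono fun x hx => by simp only [hx])
  have hinj : Function.Injective fun j : ℕ => (j : ℤ) * n := fun a b hab => by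
    simpa [hn] using hab
  have := (hT.tendsto_autocov hδ hσ).comp hinj.tendsto_cofinite
  simp only [Function.comp_def, hone] at this
  exact one_ne_zero (tendsto_nhds_unique tendsto_const_nhds this)

theorem exists_autocov_le [IsProbabilityMeasure σ] (hT : IsGaussianAutomorphism m T σ f) {δ : ℝ}
    (hδ : 0 < δ) (hσ : HasPolynomialFourierDecay σ δ) :
    ∃ q : ℝ, 0 < q ∧ q < 1 ∧ ∀ n : ℤ, n ≠ 0 → autocov m T f n ≤ q := by
  have hfin : {n : ℤ | ¬ autocov m T f n < 1 / 2}.Finite :=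
    (hT.tendsto_autocov hδ hσ).eventually (gt_mem_nhds (by norm_num : (0 : ℝ) < 1 / 2))
  -- Only finitely many values are `1 / 2` or more, and those at `n ≠ 0` are below `1`.
  have hall : ∀ᶠ q in 𝓝[<] (1 : ℝ),
      ∀ n ∈ {n : ℤ | ¬ autocov m T f n < 1 / 2} ∩ {n | n ≠ 0}, autocov m T f n ≤ q :=
    (hfin.subset Set.inter_subset_left).eventually_all.2 fun n hn =>
      mem_of_superset (Ioo_mem_nhdsLT (hT.autocov_lt_one hδ hσ hn.2)) fun q hq => hq.1.le
  obtain ⟨q, hq2, hq, hq1⟩ :=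
    (hall.and (Ioo_mem_nhdsLT (by norm_num : (1 / 2 : ℝ) < 1))).exists
  refine ⟨q, by linarith, hq1, fun n hn => ?_⟩
  by_cases h : autocov m T f n < 1 / 2
  · exact h.le.trans hq.le
  · exact hq2 n ⟨h, hn⟩

/-- `f` is a standard normal variable, so it charges every interval. -/
theorem measure_preimage_Ioo_pos [IsProbabilityMeasure m] [IsProbabilityMeasure σ]
    (hT : IsGaussianAutomorphism m T σ f) {a b : ℝ} (hab : a < b) :
    0 < m (f ⁻¹' Set.Ioo a b) := by
  have hlaw := (hT.isGaussianProcess.hasGaussianLaw_eval 0).map_eq_gaussianReal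
  rw [← covariance_self (hT.memLp_comp_iter 0).aemeasurable, hT.covariance_zero_iter,
    hT.autocov_zero] at hlaw
  have := Measure.map_apply (μ := m) (hT.measurable_comp_iter 0)
    (measurableSet_Ioo (a := a) (b := b))
  rw [hlaw] at this
  change _ = m (f ⁻¹' _) at this
  rw [← this]
  refine pos_iff_ne_zero.2 fun h0 => ?_
  have := gaussianReal_absolutelyContinuous' _ (by simp) h0
  simp [hab.not_ge] at this

theorem norm_eq_one [IsProbabilityMeasure σ] (hT : IsGaussianAutomorphism m T σ f) :
    ‖f‖ = 1 := by
  have h : ⟪f, f⟫_ℝ = 1 := by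
    rw [L2.inner_def, ← hT.integral_sq]
    rfl
  rw [real_inner_self_eq_norm_sq] at h
  nlinarith [norm_nonneg f]

/-! ### The reflection as a point transformation -/

/-- Modulo `m`, a point is a measurable function of its path `n ↦ f (Tⁿ x)`. -/
theorem exists_ae_leftInverse [StandardBorelSpace X] [IsProbabilityMeasure m]
    (hT : IsGaussianAutomorphism m T σ f) :
    ∃ G : (ℤ → ℝ) → X, Measurable G ∧ ∀ᵐ x ∂m, G (fun n => f (iter T n x)) = x := by
  have : Nonempty X := nonempty_of_isProbabilityMeasure m
  refine exists_measurable_ae_leftInverse _ fun A hA => ?_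
  obtain ⟨A', hA', hAA'⟩ := hT.generates A hA
  have : (⨆ n : ℤ, MeasurableSpace.comap (fun x => f (iter T n x)) (borel ℝ)) =
      MeasurableSpace.comap (fun x n => f (iter T n x)) MeasurableSpace.pi := by
    simp only [MeasurableSpace.pi, MeasurableSpace.comap_iSup, MeasurableSpace.comap_comp]
    rfl
  rw [this] at hA'
  obtain ⟨C, hC, rfl⟩ := hA'
  exact ⟨C, hC, hAA'⟩

/-- The point transformation that realizes `W`. In terms of paths, `W` is the linear involution
`a ↦ (n ↦ 2 σ̂(n) a₀ - aₙ)`; it preserves the law of the process `f ∘ Tⁿ`, and the path map, being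
an isomorphism modulo `m`, carries it to an involution of `X`. -/
theorem exists_reflection [StandardBorelSpace X] [IsProbabilityMeasure m]
    [IsProbabilityMeasure σ] (hT : IsGaussianAutomorphism m T σ f) :
    ∃ e : X ≃ᵐ X, MeasurePreserving e m m ∧ (∀ x, e (e x) = x) ∧
      ∀ᵐ x ∂m, ∀ n : ℤ, f (iter T n (e x)) = 2 * autocov m T f n * f x - f (iter T n x) := by
  obtain ⟨G, hG, hGF⟩ := hT.exists_ae_leftInverse
  set F : X → ℤ → ℝ := fun x n => f (iter T n x) with hF
  have hFm : Measurable F := measurable_pi_iff.2 hT.measurable_comp_iter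
  let R : (ℤ → ℝ) → ℤ → ℝ := fun a n => 2 * autocov m T f n * a 0 - a n
  have hRm : Measurable R := by fun_prop
  have hRR : ∀ a, R (R a) = a := fun a => by
    funext n
    simp only [R, hT.autocov_zero]
    ring
  have hRmap : (m.map F).map R = m.map F := by
    have h := map_reflection_eq hT.isGaussianProcess hT.measurable_comp_iter
      hT.integral_comp_iter 0 ((hT.covariance_zero_iter 0).trans hT.autocov_zero)
    simp only [hT.covariance_zero_iter] at h
    rw [Measure.map_map hRm hFm]
    exact h
  have hRF : MeasurePreserving R (m.map F) (m.map F) := ⟨hRm, hRmap⟩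
  have hGmp : MeasurePreserving G (m.map F) m := ⟨hG, by
    rw [Measure.map_map hG hFm, Measure.map_congr (f := G ∘ F) (g := id) hGF, Measure.map_id]⟩
  have hFmp : MeasurePreserving F m (m.map F) := ⟨hFm, rfl⟩
  have hFG : ∀ᵐ a ∂m.map F, F (G a) = a :=
    (ae_map_iff hFm.aemeasurable (measurableSet_eq_fun (hFm.comp hG) measurable_id)).2
      (hGF.mono fun x hx => congrArg F hx)
  have hFV : ∀ᵐ x ∂m, F (G (R (F x))) = R (F x) :=
    hFmp.quasiMeasurePreserving.ae (hRF.quasiMeasurePreserving.ae hFG)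
  obtain ⟨e, hee, heV⟩ := exists_measurableEquiv_of_ae_involutive (m := m) (V := G ∘ R ∘ F)
    (hG.comp (hRm.comp hFm)) (by
      filter_upwards [hFV, hGF] with x hx hx'
      simp only [Function.comp_apply]
      rw [hx, hRR, hx'])
  refine ⟨e, ⟨e.measurable, ?_⟩, hee, ?_⟩
  · rw [Measure.map_congr heV]
    exact (hGmp.comp (hRF.comp hFmp)).map_eq
  · filter_upwards [heV, hFV] with x hx hx' n
    rw [hx]
    exact congrFun hx' n

end IsGaussianAutomorphism

/-! ### The conjugate transformation -/

theorem signFlip_eq {X : Type*} [MeasurableSpace X] {m : Measure X} {f : Lp ℝ 2 m}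
    (hf : ‖f‖ = 1) (g : Lp ℝ 2 m) : signFlip f g = (2 * ⟪f, g⟫_ℝ) • f - g := by
  rw [signFlip, Submodule.starProjection_unit_singleton ℝ hf, mul_smul, two_smul]
  abel

namespace IsGaussianAutomorphism

variable {X : Type*} [MeasurableSpace X] {m : Measure X} {T : X ≃ᵐ X}
  {σ : Measure (AddCircle (2 * Real.pi))} {f : Lp ℝ 2 m}

/-- Stated for any `L²` class represented by `f ∘ Tⁿ`, the form in which the generators of
`gaussianSpace` are given. -/
theorem inner_eq_autocov {g : Lp ℝ 2 m} {n : ℤ}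
    (hg : g =ᵐ[m] fun x => f (iter T n x)) : ⟪f, g⟫_ℝ = autocov m T f n := by
  rw [L2.inner_def, autocov]
  refine integral_congr_ae (hg.mono fun x hx => ?_)
  simp [hx, mul_comm]

/-- Let `e` be an involution whose Koopman operator maps each `f ∘ Tⁿ` to its image under `W`. Then
the Koopman operator of `e ∘ T ∘ e⁻¹` is `W U W` on the Gaussian space: both sides are continuous
and linear, and they agree on the functions `f ∘ Tⁿ`. -/
theorem koopman_conj_eq [IsProbabilityMeasure σ] (hT : IsGaussianAutomorphism m T σ f)
    {e : X ≃ᵐ X} (hem : MeasurePreserving e m m) (hee : ∀ x, e (e x) = x)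
    (he : ∀ᵐ x ∂m, ∀ n : ℤ, f (iter T n (e x)) = 2 * autocov m T f n * f x - f (iter T n x))
    (hS : MeasurePreserving ((e.symm.trans T).trans e) m m) {g : Lp ℝ 2 m}
    (hg : g ∈ gaussianSpace T f) :
    koopman ((e.symm.trans T).trans e) hS g =
      signFlip f (koopman T hT.measurePreserving (signFlip f g)) := by
  have hsymm : ∀ x, e.symm x = e x := fun x => by
    rw [e.symm_apply_eq, hee]
  have hTm := hT.measurePreserving
  let W : Lp ℝ 2 m →L[ℝ] Lp ℝ 2 m :=
    (2 : ℝ) • (innerSL ℝ f).smulRight f - ContinuousLinearMap.id ℝ _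
  have hW : ∀ g, signFlip f g = W g := fun g => by
    simp [W, signFlip_eq hT.norm_eq_one, mul_smul]
  let U := (koopman T hTm).toContinuousLinearMap
  have hU : ∀ g : Lp ℝ 2 m, U g =ᵐ[m] fun x => g (T x) := fun g =>
    Lp.coeFn_compMeasurePreserving g hTm
  suffices h : Set.EqOn (koopman _ hS).toContinuousLinearMap (W ∘L U ∘L W)
      {g : Lp ℝ 2 m | ∃ n : ℤ, g =ᵐ[m] fun x => f (iter T n x)} by
    simpa [hW, U] using ContinuousLinearMap.eqOn_closure_span h hg
  rintro g ⟨n, hg⟩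
  have hUf : U f =ᵐ[m] fun x => f (iter T 1 x) := (hU f).trans (by simp [iter_one])
  have hUg : U g =ᵐ[m] fun x => f (iter T (n + 1) x) := by
    filter_upwards [hU g, hTm.quasiMeasurePreserving.ae hg] with x hx hx'
    rw [hx, hx', iter_add, iter_one]
  have hrhs : (W ∘L U ∘L W) g = (2 * (2 * autocov m T f n * autocov m T f 1 -
      autocov m T f (n + 1))) • f - ((2 * autocov m T f n) • U f - U g) := by
    simp only [ContinuousLinearMap.comp_apply, ← hW, signFlip_eq hT.norm_eq_one, map_sub, map_smul,
      inner_sub_right, inner_smul_right, inner_eq_autocov hg, inner_eq_autocov hUf,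
      inner_eq_autocov hUg]
  rw [hrhs]
  refine Lp.ext ?_
  have hlhs : (koopman _ hS).toContinuousLinearMap g =ᵐ[m]
      fun x => g (((e.symm.trans T).trans e) x) := Lp.coeFn_compMeasurePreserving g hS
  refine hlhs.trans ?_
  filter_upwards [hS.quasiMeasurePreserving.ae hg, he,
    (hTm.comp hem).quasiMeasurePreserving.ae he, hUf, hUg,
    Lp.coeFn_sub ((2 * (2 * autocov m T f n * autocov m T f 1 -
      autocov m T f (n + 1))) • f) ((2 * autocov m T f n) • U f - U g),
    Lp.coeFn_smul (2 * (2 * autocov m T f n * autocov m T f 1 - autocov m T f (n + 1))) f,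
    Lp.coeFn_sub ((2 * autocov m T f n) • U f) (U g),
    Lp.coeFn_smul (2 * autocov m T f n) (U f)] with x h1 h2 h3 h4 h5 h6 h7 h8 h9
  rw [h1, h6, Pi.sub_apply, h7, h8, Pi.sub_apply, h9, Pi.smul_apply, Pi.smul_apply, h4, h5]
  have h3n := h3 n
  have h21 := h2 1
  have h2n := h2 (n + 1)
  simp only [Function.comp_apply, iter_add, iter_one] at h3n h21 h2n
  simp only [MeasurableEquiv.trans_apply, hsymm, iter_add, iter_one, smul_eq_mul]
  rw [h3n, h21, h2n]
  ring

/-- The functions `f ∘ Sⁿ` for `S = e ∘ T ∘ e⁻¹`: as `W f = f`, they are `W (f ∘ Tⁿ)`. -/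
theorem comp_iter_conj [IsProbabilityMeasure σ] (hT : IsGaussianAutomorphism m T σ f)
    {e : X ≃ᵐ X} (hem : MeasurePreserving e m m) (hee : ∀ x, e (e x) = x)
    (he : ∀ᵐ x ∂m, ∀ n : ℤ, f (iter T n (e x)) = 2 * autocov m T f n * f x - f (iter T n x)) :
    ∀ᵐ x ∂m, ∀ n : ℤ, f (iter ((e.symm.trans T).trans e) n x) =
      2 * autocov m T f n * f x - f (iter T n x) := by
  have hsymm : ∀ x, e.symm x = e x := fun x => by
    rw [e.symm_apply_eq, hee]
  filter_upwards [he, ae_all_iff.2 fun n : ℤ => ((measurePreserving_iter hT.measurePreserving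
    n).comp hem).quasiMeasurePreserving.ae he] with x h1 h2 n
  have h20 := h2 n 0
  have h10 := h1 0
  simp only [Function.comp_apply, iter_zero, hT.autocov_zero] at h20 h10
  rw [iter_conj, hsymm, h20, h1 n]
  ring

end IsGaussianAutomorphism

end GaussianRecurrence

/-! ### Avoiding simultaneous recurrence -/

theorem mainTheorem3 {X : Type*} [MeasurableSpace X] [StandardBorelSpace X]
    (m : Measure X) [IsProbabilityMeasure m]
    (σ : Measure (AddCircle (2 * Real.pi))) [IsProbabilityMeasure σ]
    (δ : ℝ) (hδ : 0 < δ) (hσ : GaussianRecurrence.HasPolynomialFourierDecay σ δ)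
    (T : X ≃ᵐ X) (f : Lp ℝ 2 m) (hT : GaussianRecurrence.IsGaussianAutomorphism m T σ f)
    (k : ℕ) (hk : 1 < 2 * (k : ℝ) * δ) :
    ∃ (S : X ≃ᵐ X) (hS : MeasurePreserving S m m),
      GaussianRecurrence.Isomorphic m T S ∧
      (∀ g ∈ GaussianRecurrence.gaussianSpace T f,
        GaussianRecurrence.koopman S hS g =
          GaussianRecurrence.signFlip f
            (GaussianRecurrence.koopman T hT.measurePreserving
              (GaussianRecurrence.signFlip f g))) ∧
      ∃ B : Set (Fin k → X), MeasurableSet B ∧ 0 < Measure.pi (fun _ : Fin k => m) B ∧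
        ∀ n : ℤ, n ≠ 0 →
          B ∩ GaussianRecurrence.iter (GaussianRecurrence.cartesianPower T k) n ⁻¹' B ∩
            GaussianRecurrence.iter (GaussianRecurrence.cartesianPower S k) n ⁻¹' B = ∅ := by
  obtain ⟨e, hem, hee, he⟩ := hT.exists_reflection
  have hTm := hT.measurePreserving
  have hS : MeasurePreserving ((e.symm.trans T).trans e) m m := hem.comp (hTm.comp (hem.symm e))
  refine ⟨(e.symm.trans T).trans e, hS,
    ⟨e, e, hem, hem, .of_forall hee, .of_forall hee, .of_forall fun x => ?_⟩,
    fun g hg => hT.koopman_conj_eq hem hee he hS hg, ?_⟩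
  · simp
  set S := (e.symm.trans T).trans e
  have hflip := hT.comp_iter_conj hem hee he
  obtain ⟨q, hq0, hq1, hq⟩ := hT.exists_autocov_le hδ hσ
  have hfm : Measurable f := (Lp.stronglyMeasurable f).measurable
  -- Discarding a null set makes the formula for `f ∘ Sⁿ` valid at every point of `D`.
  let D : Set X := f ⁻¹' Set.Ioo q 1 ∩ {x | ∀ n : ℤ, f (GaussianRecurrence.iter S n x) =
      2 * GaussianRecurrence.autocov m T f n * f x - f (GaussianRecurrence.iter T n x)}
  have hD : MeasurableSet D := by
    refine (hfm measurableSet_Ioo).inter ?_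
    simp only [Set.ofPred_forall]
    exact .iInter fun n => measurableSet_eq_fun
      (hfm.comp (GaussianRecurrence.measurePreserving_iter hS n).measurable)
      ((hfm.const_mul _).sub (hT.measurable_comp_iter n))
  have hDpos : 0 < m D := by
    rw [show m D = m (f ⁻¹' Set.Ioo q 1) from measure_inter_conull hflip]
    exact hT.measure_preimage_Ioo_pos hq1
  have hk0 : 0 < k := Nat.pos_of_ne_zero fun h => by simp [h] at hk; linarith
  refine ⟨Set.univ.pi fun _ => D, .univ_pi fun _ => hD, ?_, fun n hn => ?_⟩
  · rw [Measure.pi_pi]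
    exact pos_iff_ne_zero.2 (Finset.prod_ne_zero_iff.2 fun _ _ => hDpos.ne')
  · refine Set.eq_empty_iff_forall_notMem.2 ?_
    rintro x ⟨⟨h1, h2⟩, h3⟩
    let i : Fin k := ⟨0, hk0⟩
    have h1 := h1 i trivial
    have h2 := (h2 i trivial).1
    have h3 := (h3 i trivial).1
    rw [GaussianRecurrence.iter_cartesianPower] at h2 h3
    have hrel := h1.2 n
    obtain ⟨⟨h1a, h1b⟩, -⟩ := h1
    obtain ⟨h2a, h2b⟩ := h2
    obtain ⟨h3a, h3b⟩ := h3
    rw [hrel] at h3a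
    -- The two values at time `n` both exceed `q`, but their sum is `2 σ̂(n) f(xᵢ) < 2 q`.
    have h4 : GaussianRecurrence.autocov m T f n * f (x i) ≤ q * f (x i) :=
      mul_le_mul_of_nonneg_right (hq n hn) (hq0.trans h1a).le
    nlinarith
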